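/- Let $P\subset\mathbb{R}^n$ be a convex polytope (the convex hull of finitely many points). Write $h_K(u)=\sup_{x\in K}\langle x,u\rangle$ for the support function of a convex body $K$, $B$ for the closed Euclidean unit ball, $\sigma$ for the surface measure on the unit sphere $S^{n-1}$, $\beta(P)=\min_{u\in S^{n-1}}h_P(u)$, $\operatorname{vert}P$ for the set of vertices of $P$, and $\operatorname{Norm}(v)=\{u\in\mathbb{R}^n:\langle u,z-v\rangle\le 0\text{ for all }z\in P\}$ for the normal cone of $P$ at $v$. For a convex body $K$ with the origin in its interior, let $f_K(u)\in[0,\infty]$ be its curvature function, defined for $\sigma$-almost every $u\in S^{n-1}$ as the reciprocal of the Gauss curvature $H_{n-1}(x)$ (the product of the principal curvatures, with $H_{n-1}(x)=\infty$ where the Gauss map is not differentiable, e.g. at the vertices of a polytope) at the point $x\in\partial K$ that has $u$ as outer normal. For real $s$ and real $p\neq-n$, the $s$-th mixed $p$-affine surface area of $K$ is $$as_{p,s}(K)=\int_{S^{n-1}}\bigl(f_K(u)\,h_K(u)^{1-p}\bigr)^{\frac{n-s}{n+p}}\,d\sigma(u)\in[0,\infty].$$ Let $0\le t<\beta(P)$,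 let $s\in\mathbb{R}$, and let $p\in\mathbb{R}$, $p\ne -n$, be such that $p\notin(-s,-n]$ if $n<s$, and $p\notin[-n,-s)$ if $n>s$. Then for all $m\ge 0$ and $v\in\operatorname{vert}P$ the function $h_P^{\frac{(n-s)(1-p)}{n+p}-m}$ is $\sigma$-integrable over $\operatorname{Norm}(v)\cap S^{n-1}$, and, if $t>0$ or $\frac{(n-1)(n-s)}{n+p}\ge 0$, then $as_{p,s}(P+tB)$ is finite and $$as_{p,s}(P+tB)=\sum_{m=0}^{\infty}\binom{\frac{(n-s)(1-p)}{n+p}}{m}\ \sum_{v\in\operatorname{vert}P}\ \int_{\operatorname{Norm}(v)\cap S^{n-1}}h_P(u)^{\frac{(n-s)(1-p)}{n+p}-m}\,d\sigma(u)\ \, t^{\,m+\frac{(n-1)(n-s)}{n+p}},$$ where the series converges absolutely, $\binom{\alpha}{m}=\alpha(\alpha-1)\cdots(\alpha-m+1)/m!$ and $0^0=1$. In the remaining case $t=0$, $\frac{(n-1)(n-s)}{n+p}<0$, in which the right-hand side contains negative powers of $0$, one has $as_{p,s}(P)=\infty$. -/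

import Mathlib

open MeasureTheory
open scoped Pointwise ENNReal

/-- A convex polytope: the convex hull of finitely many points. -/
def IsConvexPolytope {n : ℕ} (P : Set (EuclideanSpace ℝ (Fin n))) : Prop :=
  ∃ F : Finset (EuclideanSpace ℝ (Fin n)), P = convexHull ℝ (F : Set (EuclideanSpace ℝ (Fin n)))

/-- The support function `h_K(u) = sup_{x ∈ K} ⟨x, u⟩`. -/
noncomputable def supportFn {n : ℕ} (K : Set (EuclideanSpace ℝ (Fin n)))
    (u : EuclideanSpace ℝ (Fin n)) : ℝ :=
  sSup ((fun x => inner ℝ x u) '' K)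

/-- `β(K)`, the minimum of the support function over the unit sphere. -/
noncomputable def minSupport {n : ℕ} (K : Set (EuclideanSpace ℝ (Fin n))) : ℝ :=
  ⨅ u : Metric.sphere (0 : EuclideanSpace ℝ (Fin n)) 1, supportFn K u

/-- The normal cone `Norm(x)` of `K` at `x`. -/
def normalCone {n : ℕ} (K : Set (EuclideanSpace ℝ (Fin n))) (x : EuclideanSpace ℝ (Fin n)) :
    Set (EuclideanSpace ℝ (Fin n)) :=
  {u | ∀ z ∈ K, inner ℝ u (z - x) ≤ 0}

/-- `W` is a Weingarten map of `K` at the boundary point `x`, i.e. a differential at `x` of the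
Gauss map `ν` of `K`, with `ν(x) = u`:  for `y ∈ ∂K` and every outer unit normal `v` of `K` at `y`,
`v = u + W (y - x) + o(‖y - x‖)`. Taking `y = x` shows that `u` is then the only outer unit normal
at `x`; at the neighbouring boundary points the normal need not be unique.
Only the restriction of `W` to the tangent space `uᗮ` matters. -/
def IsWeingartenMap {n : ℕ} (K : Set (EuclideanSpace ℝ (Fin n))) (x u : EuclideanSpace ℝ (Fin n))
    (W : EuclideanSpace ℝ (Fin n) →L[ℝ] EuclideanSpace ℝ (Fin n)) : Prop :=
  ‖u‖ = 1 ∧ u ∈ normalCone K x ∧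
    ∀ ε > 0, ∃ δ > 0, ∀ y ∈ frontier K, ‖y - x‖ < δ →
      ∀ v ∈ normalCone K y, ‖v‖ = 1 → ‖v - u - W (y - x)‖ ≤ ε * ‖y - x‖

/-- The determinant of a linear map `W`, regarded as an endomorphism of the hyperplane `uᗮ`. -/
noncomputable def tangentialDet {n : ℕ} (u : EuclideanSpace ℝ (Fin n))
    (W : EuclideanSpace ℝ (Fin n) →L[ℝ] EuclideanSpace ℝ (Fin n)) : ℝ :=
  LinearMap.det
    (((ℝ ∙ u)ᗮ.orthogonalProjectionOnto ∘L W ∘L (ℝ ∙ u)ᗮ.subtypeL :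
      (ℝ ∙ u)ᗮ →L[ℝ] (ℝ ∙ u)ᗮ) : (ℝ ∙ u)ᗮ →ₗ[ℝ] (ℝ ∙ u)ᗮ)

/-- `κ` is the Gauss curvature of `K` at the boundary point `x`: the determinant of the Weingarten
map (that is, the product of the principal curvatures). -/
def HasGaussCurvature {n : ℕ} (K : Set (EuclideanSpace ℝ (Fin n)))
    (x : EuclideanSpace ℝ (Fin n)) (κ : ℝ) : Prop :=
  ∃ u W, IsWeingartenMap K x u W ∧ κ = tangentialDet u W

open Classical in
/-- The Gauss curvature `H_{n-1}(x)` as an element of `[0, ∞]`. It is `∞` at the boundary points at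
which the Gauss map is not differentiable, such as the vertices of a polytope. -/
noncomputable def gaussCurvature {n : ℕ} (K : Set (EuclideanSpace ℝ (Fin n)))
    (x : EuclideanSpace ℝ (Fin n)) : ℝ≥0∞ :=
  if h : ∃ κ, HasGaussCurvature K x κ then ENNReal.ofReal h.choose else ⊤

/-- The curvature function `f_K(u) ∈ [0, ∞]`: the reciprocal of the Gauss curvature at the boundary
point of `K` that has `u` as an outer normal. For almost every `u` in the unit sphere this
point is unique; if it is not, the supremum over all such points is taken. -/
noncomputable def curvatureFn {n : ℕ} (K : Set (EuclideanSpace ℝ (Fin n)))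
    (u : EuclideanSpace ℝ (Fin n)) : ℝ≥0∞ :=
  ⨆ x ∈ {x | x ∈ frontier K ∧ u ∈ normalCone K x}, (gaussCurvature K x)⁻¹

/-- The `L_p` curvature function `f_p(K, u) = f_K(u) h_K(u)^{1-p}`. -/
noncomputable def lpCurvatureFn {n : ℕ} (p : ℝ) (K : Set (EuclideanSpace ℝ (Fin n)))
    (u : EuclideanSpace ℝ (Fin n)) : ℝ≥0∞ :=
  curvatureFn K u * ENNReal.ofReal (supportFn K u) ^ (1 - p)

/-- The spherical measure `σ` on the unit sphere of `ℝⁿ`. -/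
noncomputable def sphereMeasure (n : ℕ) :
    Measure (Metric.sphere (0 : EuclideanSpace ℝ (Fin n)) 1) :=
  (volume : Measure (EuclideanSpace ℝ (Fin n))).toSphere

/-- The `s`-th mixed `p`-affine surface area
`as_{p,s}(K) = ∫_{S^{n-1}} f_p(K, u)^{(n-s)/(n+p)} dσ(u)`, an element of `[0, ∞]`. -/
noncomputable def mixedAffineSurfaceArea {n : ℕ} (p s : ℝ)
    (K : Set (EuclideanSpace ℝ (Fin n))) : ℝ≥0∞ :=
  ∫⁻ u, lpCurvatureFn p K u ^ (((n : ℝ) - s) / ((n : ℝ) + p)) ∂(sphereMeasure n)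

/-- The part of the unit sphere that lies in the normal cone of `P` at `v`. -/
def sphericalNormalCone {n : ℕ} (P : Set (EuclideanSpace ℝ (Fin n)))
    (v : EuclideanSpace ℝ (Fin n)) : Set (Metric.sphere (0 : EuclideanSpace ℝ (Fin n)) 1) :=
  {u | (u : EuclideanSpace ℝ (Fin n)) ∈ normalCone P v}

/-! Almost every direction `u` exposes a single vertex `v` of `P`, and then so do all directions
near `u`, with the same `v`. Hence, for `t > 0`, the parallel body meets its supporting hyperplane
with normal `u` only at `v + t u`, and near that point its boundary is a piece of the sphere of
radius `t` about `v`. So `f = t ^ (n - 1)` and `h = h_P + t` almost everywhere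
(`Exposes.curvatureFn_add_smul_closedBall`, `Exposes.supportFn_add_smul_closedBall`). With `q = (n -
s) / (n + p)` the surface area becomes `t ^ ((n - 1) q)` times the integral of `(h_P + t) ^ ((1 - p)
q)`.

Since `t < β(P) ≤ h_P`, the binomial series in `t / h_P` converges uniformly and can be integrated
termwise (`hasSum_integral_rpow_add`). The spherical normal cones of the vertices tile the sphere up
to a null set, which splits each coefficient (`finsum_integral_sphericalNormalCone`).

For `t = 0` and `n ≥ 2` the Gauss map is not differentiable at a vertex, so `f = 0`, and a negative
`q` makes the integrand `∞`. For `n = 1` the curvature is an empty determinant, equal to `1`, in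
agreement with `0 ^ 0 = 1`. -/

/-- `v` is the unique point of `P` at which the linear functional `⟨·, u⟩` is maximal. -/
def Exposes {n : ℕ} (P : Set (EuclideanSpace ℝ (Fin n))) (v u : EuclideanSpace ℝ (Fin n)) : Prop :=
  v ∈ P ∧ ∀ z ∈ P, z ≠ v → inner ℝ z u < inner ℝ v u

/-! ### Support functions, normal cones and exposed vertices -/

section Support

variable {n : ℕ} {P : Set (EuclideanSpace ℝ (Fin n))} {u v x : EuclideanSpace ℝ (Fin n)}

theorem IsConvexPolytope.isCompact (hP : IsConvexPolytope P) : IsCompact P := by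
  obtain ⟨F, rfl⟩ := hP
  exact F.finite_toSet.isCompact_convexHull ℝ

theorem IsConvexPolytope.finite_extremePoints (hP : IsConvexPolytope P) :
    (Set.extremePoints ℝ P).Finite := by
  obtain ⟨F, rfl⟩ := hP
  exact F.finite_toSet.subset extremePoints_convexHull_subset

theorem continuous_supportFn (hP : IsCompact P) : Continuous (supportFn P) := by
  unfold supportFn
  exact hP.continuous_sSup (f := fun u x => inner ℝ x u) (by fun_prop)

theorem supportFn_eq_of_forall_le (hx : x ∈ P) (h : ∀ z ∈ P, inner ℝ z u ≤ inner ℝ x u) :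
    supportFn P u = inner ℝ x u := by
  refine IsGreatest.csSup_eq ⟨⟨x, hx, rfl⟩, ?_⟩
  rintro _ ⟨z, hz, rfl⟩
  exact h z hz

theorem minSupport_le_supportFn (hP : IsCompact P)
    (u : Metric.sphere (0 : EuclideanSpace ℝ (Fin n)) 1) : minSupport P ≤ supportFn P u := by
  refine ciInf_le ?_ u
  exact (isCompact_range ((continuous_supportFn hP).comp continuous_subtype_val)).bddBelow

theorem nonempty_of_minSupport_pos (h : 0 < minSupport P) : P.Nonempty := by
  by_contra hne
  rw [Set.not_nonempty_iff_eq_empty] at hne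
  subst hne
  simp [minSupport, supportFn] at h

theorem pos_dim_of_minSupport_pos (h : 0 < minSupport P) : 0 < n := by
  rcases Nat.eq_zero_or_pos n with rfl | hn
  · have : IsEmpty (Metric.sphere (0 : EuclideanSpace ℝ (Fin 0)) 1) := by
      constructor
      rintro ⟨x, hx⟩
      rw [Subsingleton.elim x 0] at hx
      simp at hx
    -- The infimum over the empty sphere takes the default value `0`.
    simp [minSupport] at h
  · exact hn

theorem Exposes.inner_le (h : Exposes P v u) (hx : x ∈ P) : inner ℝ x u ≤ inner ℝ v u := by
  rcases eq_or_ne x v with rfl | hne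
  · exact le_rfl
  · exact (h.2 x hx hne).le

theorem Exposes.eq_of_le (h : Exposes P v u) (hx : x ∈ P) (hle : inner ℝ v u ≤ inner ℝ x u) :
    x = v := by
  by_contra hne
  exact absurd hle (not_le.2 (h.2 x hx hne))

theorem Exposes.supportFn_eq (h : Exposes P v u) : supportFn P u = inner ℝ v u :=
  supportFn_eq_of_forall_le h.1 fun _ hz => h.inner_le hz

theorem mem_normalCone_iff : u ∈ normalCone P v ↔ ∀ z ∈ P, inner ℝ z u ≤ inner ℝ v u := by
  simp only [normalCone, Set.mem_ofPred_eq, inner_sub_right, sub_nonpos]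
  simp only [real_inner_comm]

theorem Exposes.mem_normalCone_iff_eq (h : Exposes P v u) (hx : x ∈ P) :
    u ∈ normalCone P x ↔ x = v := by
  rw [mem_normalCone_iff]
  refine ⟨fun hu => h.eq_of_le hx (hu v h.1), ?_⟩
  rintro rfl z hz
  exact h.inner_le hz

theorem Exposes.mem_extremePoints (h : Exposes P v u) : v ∈ Set.extremePoints ℝ P := by
  refine ⟨h.1, fun x hx y hy hv => ?_⟩
  obtain ⟨a, b, ha, hb, hab, hxy⟩ := hv
  have hi : inner ℝ v u = a * inner ℝ x u + b * inner ℝ y u := by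
    rw [← hxy, inner_add_left, inner_smul_left, inner_smul_left]; rfl
  have hx' := h.inner_le hx
  have hy' := h.inner_le hy
  refine h.eq_of_le hx ?_
  have : b = 1 - a := by linarith
  subst this
  nlinarith

/-- An open half-space together with the single boundary point `v` is still convex, so strict
maximality need only be tested on generators. -/
theorem exposes_convexHull {F : Set (EuclideanSpace ℝ (Fin n))} (hv : v ∈ convexHull ℝ F)
    (h : ∀ z ∈ F, z ≠ v → inner ℝ z u < inner ℝ v u) : Exposes (convexHull ℝ F) v u := by
  refine ⟨hv, ?_⟩
  have key : convexHull ℝ F ⊆ {z | z ≠ v → inner ℝ z u < inner ℝ v u} := by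
    refine convexHull_min h ?_
    intro x hx y hy a b ha hb hab hne
    simp only [Set.mem_ofPred_eq] at hx hy
    have hb' : b = 1 - a := by linarith
    rw [inner_add_left, inner_smul_left, inner_smul_left]
    simp only [conj_trivial]
    rcases eq_or_ne x v with rfl | hxv
    · rcases eq_or_ne y x with rfl | hyx
      · exact absurd (by rw [← add_smul, hab, one_smul]) hne
      · have hb0 : 0 < b := by
          rcases hb.eq_or_lt with rfl | hb0
          · exact absurd (by simp [show a = 1 by linarith]) hne
          · exact hb0
        rw [show a = 1 - b by linarith]
        linarith [mul_lt_mul_of_pos_left (hy hyx) hb0]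
    · rcases eq_or_ne y v with rfl | hyv
      · have ha0 : 0 < a := by
          rcases ha.eq_or_lt with rfl | ha0
          · exact absurd (by simp [show b = 1 by linarith]) hne
          · exact ha0
        rw [hb']
        linarith [mul_lt_mul_of_pos_left (hx hxv) ha0]
      · have h1 := hx hxv
        have h2 := hy hyv
        subst hb'
        rcases ha.eq_or_lt with rfl | ha0
        · linarith
        · nlinarith
  exact fun z hz => key hz

/-- Exposure amounts to finitely many strict inequalities on the generators, each open in the
direction. This is where polytopality enters the curvature computation. -/
theorem Exposes.exists_nhds (hP : IsConvexPolytope P) (h : Exposes P v u) :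
    ∃ δ > 0, ∀ w : EuclideanSpace ℝ (Fin n), ‖w - u‖ < δ → Exposes P v w := by
  obtain ⟨F, rfl⟩ := hP
  have hU : ∀ᶠ w in nhds u, ∀ z ∈ F, z ≠ v → inner ℝ z w < inner ℝ v w := by
    rw [Filter.eventually_all_finset]
    intro z hz
    rcases eq_or_ne z v with rfl | hne
    · simp
    · have : ∀ᶠ w in nhds u, inner ℝ z w < inner ℝ v w :=
        (isOpen_lt (by fun_prop) (by fun_prop)).mem_nhds (h.2 z (subset_convexHull ℝ _ hz) hne)
      filter_upwards [this] with w hw _ using hw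
  obtain ⟨δ, hδ, hball⟩ := Metric.eventually_nhds_iff.1 hU
  refine ⟨δ, hδ, fun w hw => exposes_convexHull h.1 fun z hz => hball ?_ z hz⟩
  rwa [dist_eq_norm]

/-- `toSphere` measures a set through the cone over it, and here that cone lies in the hyperplane
orthogonal to `a - b`. -/
theorem ae_ne_inner {a b : EuclideanSpace ℝ (Fin n)} (hab : a ≠ b) :
    ∀ᵐ u : Metric.sphere (0 : EuclideanSpace ℝ (Fin n)) 1 ∂(sphereMeasure n),
      inner ℝ a (u : EuclideanSpace ℝ (Fin n)) ≠ inner ℝ b u := by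
  have hm : MeasurableSet {u : Metric.sphere (0 : EuclideanSpace ℝ (Fin n)) 1 |
      inner ℝ a (u : EuclideanSpace ℝ (Fin n)) = inner ℝ b u} :=
    (isClosed_eq (by fun_prop) (by fun_prop)).measurableSet
  rw [ae_iff]
  simp only [ne_eq, not_not]
  rw [sphereMeasure, Measure.toSphere_apply' _ hm]
  have hsub : Set.Ioo (0 : ℝ) 1 • ((↑) '' {u : Metric.sphere (0 : EuclideanSpace ℝ (Fin n)) 1 |
      inner ℝ a (u : EuclideanSpace ℝ (Fin n)) = inner ℝ b u}) ⊆
      (((ℝ ∙ (a - b))ᗮ : Submodule ℝ (EuclideanSpace ℝ (Fin n))) :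
        Set (EuclideanSpace ℝ (Fin n))) := by
    rintro _ ⟨r, -, _, ⟨u, hu, rfl⟩, rfl⟩
    simp only [Set.mem_ofPred_eq] at hu
    rw [SetLike.mem_coe, Submodule.mem_orthogonal_singleton_iff_inner_right]
    simp [inner_smul_right, inner_sub_left, hu]
  have hne : (ℝ ∙ (a - b))ᗮ ≠ ⊤ := by
    intro h
    have : a - b ∈ (ℝ ∙ (a - b))ᗮ := h ▸ Submodule.mem_top
    rw [Submodule.mem_orthogonal_singleton_iff_inner_right, inner_self_eq_zero, sub_eq_zero] at this
    exact hab this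
  rw [measure_mono_null hsub (Measure.addHaar_submodule _ _ hne), mul_zero]

/-- Off finitely many null sets `u` takes distinct values at distinct generators, so the maximum
over them is attained once. -/
theorem IsConvexPolytope.ae_exposes (hP : IsConvexPolytope P) (hne : P.Nonempty) :
    ∀ᵐ u : Metric.sphere (0 : EuclideanSpace ℝ (Fin n)) 1 ∂(sphereMeasure n),
      ∃ v, Exposes P v u := by
  obtain ⟨F, rfl⟩ := hP
  rw [convexHull_nonempty_iff, Finset.coe_nonempty] at hne
  have h : ∀ᵐ u : Metric.sphere (0 : EuclideanSpace ℝ (Fin n)) 1 ∂(sphereMeasure n),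
      ∀ a ∈ F, ∀ b ∈ F, a ≠ b → inner ℝ a (u : EuclideanSpace ℝ (Fin n)) ≠ inner ℝ b u := by
    rw [Filter.eventually_all_finset]
    intro a _
    rw [Filter.eventually_all_finset]
    intro b _
    rcases eq_or_ne a b with rfl | hab
    · simp
    · filter_upwards [ae_ne_inner hab] with u hu _ using hu
  filter_upwards [h] with u hu
  obtain ⟨v, hv, hmax⟩ := F.exists_max_image (fun z => inner ℝ z (u : EuclideanSpace ℝ (Fin n))) hne
  exact ⟨v, exposes_convexHull (subset_convexHull ℝ _ hv) fun z hz hzv =>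
    (hmax z hz).lt_of_ne (hu z hz v hv hzv)⟩

end Support

/-! ### Boundary structure and Gauss curvature of the parallel body -/

section Parallel

variable {n : ℕ} {P : Set (EuclideanSpace ℝ (Fin n))} {u v x : EuclideanSpace ℝ (Fin n)} {t : ℝ}

theorem mem_add_smul_closedBall : x ∈ P + t • Metric.closedBall (0 : EuclideanSpace ℝ (Fin n)) 1 ↔
    ∃ a ∈ P, ∃ b : EuclideanSpace ℝ (Fin n), ‖b‖ ≤ 1 ∧ a + t • b = x := by
  simp [Set.mem_add, Set.mem_smul_set]

theorem isCompact_add_smul_closedBall (hP : IsCompact P) :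
    IsCompact (P + t • Metric.closedBall (0 : EuclideanSpace ℝ (Fin n)) 1) :=
  hP.add ((isCompact_closedBall _ _).smul t)

theorem eq_of_norm_le_of_one_le_inner {b : EuclideanSpace ℝ (Fin n)} (hu : ‖u‖ = 1) (hb : ‖b‖ ≤ 1)
    (h : 1 ≤ inner ℝ b u) : b = u := by
  have h1 : ‖b - u‖ ^ 2 = ‖b‖ ^ 2 - 2 * inner ℝ b u + ‖u‖ ^ 2 := norm_sub_sq_real b u
  have h2 : ‖b - u‖ ^ 2 ≤ 0 := by
    rw [h1, hu]
    nlinarith [norm_nonneg b]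
  have h3 : ‖b - u‖ = 0 := by
    have := sq_nonneg ‖b - u‖
    exact pow_eq_zero_iff (two_ne_zero) |>.1 (le_antisymm h2 this)
  exact sub_eq_zero.1 (norm_eq_zero.1 h3)

/-- A point of the parallel body with outer unit normal `w` has the form `a + t w`, where `w` is a
normal at `a`. -/
theorem exists_eq_add_smul_normal (ht : 0 ≤ t)
    (hx : x ∈ P + t • Metric.closedBall (0 : EuclideanSpace ℝ (Fin n)) 1)
    (hu : ‖u‖ = 1) (hux : u ∈ normalCone (P + t • Metric.closedBall 0 1) x) :
    ∃ a ∈ P, u ∈ normalCone P a ∧ x = a + t • u := by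
  obtain ⟨a, ha, b, hb, rfl⟩ := mem_add_smul_closedBall.1 hx
  rw [mem_normalCone_iff] at hux
  refine ⟨a, ha, ?_, ?_⟩
  · rw [mem_normalCone_iff]
    intro z hz
    have := hux (z + t • b) (mem_add_smul_closedBall.2 ⟨z, hz, b, hb, rfl⟩)
    simpa [inner_add_left] using this
  · rcases ht.eq_or_lt with rfl | ht
    · simp
    · have := hux (a + t • u) (mem_add_smul_closedBall.2 ⟨a, ha, u, hu.le, rfl⟩)
      simp only [inner_add_left, inner_smul_left, conj_trivial, real_inner_self_eq_norm_sq, hu]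
        at this
      rw [eq_of_norm_le_of_one_le_inner hu hb]
      nlinarith

theorem add_smul_mem (ha : v ∈ P) (hu : ‖u‖ = 1) :
    v + t • u ∈ P + t • Metric.closedBall (0 : EuclideanSpace ℝ (Fin n)) 1 :=
  mem_add_smul_closedBall.2 ⟨v, ha, u, hu.le, rfl⟩

theorem mem_normalCone_add_smul (ht : 0 ≤ t) (hu : ‖u‖ = 1) (hv : u ∈ normalCone P v) :
    u ∈ normalCone (P + t • Metric.closedBall 0 1) (v + t • u) := by
  rw [mem_normalCone_iff] at hv ⊢
  intro z hz
  obtain ⟨a, ha, b, hb, rfl⟩ := mem_add_smul_closedBall.1 hz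
  simp only [inner_add_left, inner_smul_left, conj_trivial, real_inner_self_eq_norm_sq, hu]
  have h1 := hv a ha
  have h2 : inner ℝ b u ≤ 1 := (real_inner_le_norm b u).trans (by rw [hu]; linarith)
  nlinarith

theorem Exposes.supportFn_add_smul_closedBall (h : Exposes P v u) (ht : 0 ≤ t) (hu : ‖u‖ = 1) :
    supportFn (P + t • Metric.closedBall 0 1) u = supportFn P u + t := by
  have hN := mem_normalCone_add_smul ht hu ((h.mem_normalCone_iff_eq h.1).2 rfl)
  rw [h.supportFn_eq, supportFn_eq_of_forall_le (add_smul_mem h.1 hu) (mem_normalCone_iff.1 hN)]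
  simp [inner_add_left, inner_smul_left, hu]

theorem mem_frontier_of_mem_normalCone {K : Set (EuclideanSpace ℝ (Fin n))} (hx : x ∈ K)
    (hu : ‖u‖ = 1) (h : u ∈ normalCone K x) : x ∈ frontier K := by
  refine ⟨subset_closure hx, fun hi => ?_⟩
  obtain ⟨ε, hε, hball⟩ := Metric.mem_nhds_iff.1 (mem_interior_iff_mem_nhds.1 hi)
  have hmem : x + (ε / 2) • u ∈ K := by
    apply hball
    rw [Metric.mem_ball, dist_eq_norm, add_sub_cancel_left, norm_smul, hu, Real.norm_eq_abs,
      abs_of_pos (by linarith)]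
    linarith
  have := mem_normalCone_iff.1 h _ hmem
  simp only [inner_add_left, inner_smul_left, conj_trivial, real_inner_self_eq_norm_sq, hu] at this
  linarith

/-- This collapses the supremum in `curvatureFn` to a single boundary point. -/
theorem Exposes.contact_set_eq (h : Exposes P v u) (hP : IsCompact P) (ht : 0 ≤ t) (hu : ‖u‖ = 1) :
    {x | x ∈ frontier (P + t • Metric.closedBall (0 : EuclideanSpace ℝ (Fin n)) 1) ∧
      u ∈ normalCone (P + t • Metric.closedBall 0 1) x} = {v + t • u} := by
  ext x
  rw [Set.mem_singleton_iff]
  constructor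
  · rintro ⟨hx, hux⟩
    obtain ⟨a, ha, hua, rfl⟩ := exists_eq_add_smul_normal ht
      ((isCompact_add_smul_closedBall hP).isClosed.frontier_subset hx) hu hux
    rw [(h.mem_normalCone_iff_eq ha).1 hua]
  · rintro rfl
    have hN := mem_normalCone_add_smul ht hu ((h.mem_normalCone_iff_eq h.1).2 rfl)
    exact ⟨mem_frontier_of_mem_normalCone (add_smul_mem h.1 hu) hu hN, hN⟩

theorem Exposes.curvatureFn_eq (h : Exposes P v u) (hP : IsCompact P) (ht : 0 ≤ t) (hu : ‖u‖ = 1) :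
    curvatureFn (P + t • Metric.closedBall 0 1) u =
      (gaussCurvature (P + t • Metric.closedBall 0 1) (v + t • u))⁻¹ := by
  rw [curvatureFn, h.contact_set_eq hP ht hu, iSup_singleton]

/-- The definition picks some `κ` by choice, so its value is known only once all candidates agree.
-/
theorem gaussCurvature_eq_of_unique {K : Set (EuclideanSpace ℝ (Fin n))} {κ : ℝ}
    (h : HasGaussCurvature K x κ) (huniq : ∀ κ', HasGaussCurvature K x κ' → κ' = κ) :
    gaussCurvature K x = ENNReal.ofReal κ := by
  have hex : ∃ κ, HasGaussCurvature K x κ := ⟨κ, h⟩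
  rw [gaussCurvature, dif_pos hex, huniq _ hex.choose_spec]

theorem IsWeingartenMap.eq_of_mem_normalCone {K : Set (EuclideanSpace ℝ (Fin n))}
    {W : EuclideanSpace ℝ (Fin n) →L[ℝ] EuclideanSpace ℝ (Fin n)} (h : IsWeingartenMap K x u W)
    (hx : x ∈ frontier K) {w : EuclideanSpace ℝ (Fin n)} (hw : ‖w‖ = 1) (hwx : w ∈ normalCone K x) :
    w = u := by
  obtain ⟨δ, hδ, H⟩ := h.2.2 1 one_pos
  have := H x hx (by simpa using hδ) w hwx hw
  simp only [sub_self, map_zero, sub_zero, norm_zero, mul_zero] at this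
  exact sub_eq_zero.1 (norm_le_zero_iff.1 this)

theorem finrank_orthogonal_span_unit (hn : 0 < n) (hu : ‖u‖ = 1) :
    Module.finrank ℝ (ℝ ∙ u)ᗮ = n - 1 := by
  have : Fact (Module.finrank ℝ (EuclideanSpace ℝ (Fin n)) = (n - 1) + 1) :=
    ⟨by rw [finrank_euclideanSpace_fin]; omega⟩
  exact Submodule.finrank_orthogonal_span_singleton (by rintro rfl; simp at hu)

theorem tangentialDet_eq_of_apply_eq_smul (hn : 0 < n) (hu : ‖u‖ = 1) {c : ℝ}
    {W : EuclideanSpace ℝ (Fin n) →L[ℝ] EuclideanSpace ℝ (Fin n)}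
    (hW : ∀ e, inner ℝ u e = 0 → W e = c • e) : tangentialDet u W = c ^ (n - 1) := by
  have : (((ℝ ∙ u)ᗮ.orthogonalProjectionOnto ∘L W ∘L (ℝ ∙ u)ᗮ.subtypeL :
      (ℝ ∙ u)ᗮ →L[ℝ] (ℝ ∙ u)ᗮ) : (ℝ ∙ u)ᗮ →ₗ[ℝ] (ℝ ∙ u)ᗮ) = c • LinearMap.id := by
    ext1 e
    have he := hW e (Submodule.mem_orthogonal_singleton_iff_inner_right.1 e.2)
    simp [he]
  rw [tangentialDet, this, LinearMap.det_smul, LinearMap.det_id, mul_one,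
    finrank_orthogonal_span_unit hn hu]

/-- The point at angle `θ` from `u` in the direction `e`. -/
noncomputable def greatCircle (u e : EuclideanSpace ℝ (Fin n)) (θ : ℝ) :
    EuclideanSpace ℝ (Fin n) :=
  Real.cos θ • u + Real.sin θ • e

theorem norm_greatCircle {e : EuclideanSpace ℝ (Fin n)} (hu : ‖u‖ = 1) (he : ‖e‖ = 1)
    (hue : inner ℝ u e = 0) (θ : ℝ) : ‖greatCircle u e θ‖ = 1 := by
  have : ‖greatCircle u e θ‖ ^ 2 = 1 := by
    rw [greatCircle, norm_add_sq_real, inner_smul_left, inner_smul_right, hue, norm_smul, norm_smul,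
      hu, he]
    simp
  exact (pow_eq_one_iff_of_nonneg (norm_nonneg _) two_ne_zero).1 this

theorem hasDerivAt_greatCircle (u e : EuclideanSpace ℝ (Fin n)) :
    HasDerivAt (greatCircle u e) e 0 := by
  have := ((Real.hasDerivAt_cos 0).smul_const u).add ((Real.hasDerivAt_sin 0).smul_const e)
  simpa using! this

/-- A linear map that is `o(‖w - u‖)` at `w - u` for unit vectors `w` near `u` vanishes on the
tangent space. -/
theorem apply_eq_zero_of_sphere_isLittleO
    {A : EuclideanSpace ℝ (Fin n) →L[ℝ] EuclideanSpace ℝ (Fin n)} (hu : ‖u‖ = 1)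
    (hA : ∀ ε > 0, ∃ δ > 0, ∀ w : EuclideanSpace ℝ (Fin n), ‖w‖ = 1 → ‖w - u‖ < δ →
      ‖A (w - u)‖ ≤ ε * ‖w - u‖) {e : EuclideanSpace ℝ (Fin n)} (he : inner ℝ u e = 0) :
    A e = 0 := by
  wlog he1 : ‖e‖ = 1 generalizing e
  · rcases eq_or_ne e 0 with rfl | hne
    · simp
    · have hne' : ‖e‖ ≠ 0 := norm_ne_zero_iff.2 hne
      have := this (e := ‖e‖⁻¹ • e) (by rw [inner_smul_right, he, mul_zero])
        (by rw [norm_smul, norm_inv, norm_norm, inv_mul_cancel₀ hne'])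
      rw [map_smul, smul_eq_zero] at this
      exact this.resolve_left (inv_ne_zero hne')
  have hd := hasDerivAt_greatCircle u e
  have h0 : greatCircle u e 0 = u := by simp [greatCircle]
  have hlim : Filter.Tendsto (greatCircle u e) (nhds 0) (nhds u) := by
    simpa [h0] using hd.continuousAt.tendsto
  have hO : (fun θ => greatCircle u e θ - u) =O[nhds 0] fun θ => θ := by
    simpa [h0] using hd.isBigO_sub
  have ho : (fun θ => A (greatCircle u e θ - u)) =o[nhds 0] fun θ => greatCircle u e θ - u := by
    rw [Asymptotics.isLittleO_iff]
    intro ε hε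
    obtain ⟨δ, hδ, H⟩ := hA ε hε
    filter_upwards [hlim (Metric.ball_mem_nhds u hδ)] with θ hθ
    refine H _ (norm_greatCircle hu he1 he θ) ?_
    rwa [Set.mem_preimage, Metric.mem_ball, dist_eq_norm] at hθ
  -- Along the great circle the same curve has derivative `0`, by the smallness hypothesis, and `A
  -- e`, by the chain rule.
  have h1 : HasDerivAt (fun θ => A (greatCircle u e θ - u)) 0 0 := by
    rw [hasDerivAt_iff_isLittleO]
    simpa [h0] using ho.trans_isBigO hO
  have h2 : HasDerivAt (fun θ => A (greatCircle u e θ - u)) (A e) 0 :=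
    A.hasFDerivAt.comp_hasDerivAt 0 (hd.sub_const u)
  exact h2.unique h1

/-- Normals are monotone: `⟨a - v, w - u⟩ ≥ 0`. Expanding the square of `(a - v) + t (w - u)` then
gives the bound, so for `t > 0` nearby boundary points have nearby normals. -/
theorem Exposes.exists_mul_norm_sub_le (hP : IsCompact P) (h : Exposes P v u) (ht : 0 ≤ t)
    {y w : EuclideanSpace ℝ (Fin n)}
    (hy : y ∈ frontier (P + t • Metric.closedBall (0 : EuclideanSpace ℝ (Fin n)) 1))
    (hw : ‖w‖ = 1) (hwy : w ∈ normalCone (P + t • Metric.closedBall 0 1) y) :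
    ∃ a ∈ P, w ∈ normalCone P a ∧ y = a + t • w ∧ t * ‖w - u‖ ≤ ‖y - (v + t • u)‖ := by
  obtain ⟨a, ha, hwa, rfl⟩ := exists_eq_add_smul_normal ht
    ((isCompact_add_smul_closedBall hP).isClosed.frontier_subset hy) hw hwy
  refine ⟨a, ha, hwa, rfl, ?_⟩
  have e1 : a + t • w - (v + t • u) = (a - v) + t • (w - u) := by module
  have e2 : 0 ≤ inner ℝ (a - v) (w - u) := by
    have h1 := h.inner_le ha
    have h2 := mem_normalCone_iff.1 hwa v h.1
    simp only [inner_sub_left, inner_sub_right]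
    linarith
  rw [e1]
  refine le_of_sq_le_sq ?_ (norm_nonneg _)
  rw [norm_add_sq_real, norm_smul, inner_smul_right, Real.norm_eq_abs, abs_of_nonneg ht]
  nlinarith [sq_nonneg ‖a - v‖, mul_nonneg ht e2]

theorem Exposes.isWeingartenMap_add_smul (hP : IsConvexPolytope P) (h : Exposes P v u) (ht : 0 < t)
    (hu : ‖u‖ = 1) :
    IsWeingartenMap (P + t • Metric.closedBall 0 1) (v + t • u) u
      (t⁻¹ • ContinuousLinearMap.id ℝ _) := by
  refine ⟨hu, mem_normalCone_add_smul ht.le hu ((h.mem_normalCone_iff_eq h.1).2 rfl), ?_⟩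
  intro ε hε
  obtain ⟨δ, hδ, H⟩ := h.exists_nhds hP
  refine ⟨t * δ, by positivity, fun y hy hyx w hwy hw => ?_⟩
  obtain ⟨a, ha, hwa, rfl, hle⟩ := h.exists_mul_norm_sub_le hP.isCompact ht.le hy hw hwy
  have hwu : ‖w - u‖ < δ := lt_of_mul_lt_mul_left (hle.trans_lt hyx) ht.le
  -- Normals this close to `u` are attained in `P` only at the vertex, so the boundary is exactly
  -- spherical here and the remainder vanishes.
  obtain rfl := ((H w hwu).mem_normalCone_iff_eq ha).1 hwa
  have : w - u - (t⁻¹ • ContinuousLinearMap.id ℝ (EuclideanSpace ℝ (Fin n)))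
      (a + t • w - (a + t • u)) = 0 := by
    rw [add_sub_add_left_eq_sub, ← smul_sub]
    simp [smul_smul, mul_inv_cancel₀ ht.ne']
  rw [this, norm_zero]
  positivity

theorem Exposes.gaussCurvature_add_smul (hn : 0 < n) (hP : IsConvexPolytope P) (h : Exposes P v u)
    (ht : 0 < t) (hu : ‖u‖ = 1) :
    gaussCurvature (P + t • Metric.closedBall 0 1) (v + t • u) =
      ENNReal.ofReal (t⁻¹ ^ (n - 1)) := by
  have hWt := h.isWeingartenMap_add_smul hP ht hu
  have hfr : v + t • u ∈ frontier (P + t • Metric.closedBall (0 : EuclideanSpace ℝ (Fin n)) 1) :=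
    mem_frontier_of_mem_normalCone (add_smul_mem h.1 hu) hu hWt.2.1
  refine gaussCurvature_eq_of_unique ⟨u, _, hWt,
    (tangentialDet_eq_of_apply_eq_smul hn hu fun e _ => by simp).symm⟩ ?_
  rintro κ ⟨u', W, hW, rfl⟩
  obtain rfl : u = u' := hW.eq_of_mem_normalCone hfr hu hWt.2.1
  refine tangentialDet_eq_of_apply_eq_smul hn hu fun e he => ?_
  -- Any other Weingarten map `W` is tested at the points `v + t w`, whose normal is `w`; this
  -- forces `t W = id` on the tangent space.
  have key : (ContinuousLinearMap.id ℝ (EuclideanSpace ℝ (Fin n)) - t • W) e = 0 := by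
    refine apply_eq_zero_of_sphere_isLittleO hu ?_ he
    intro ε hε
    obtain ⟨δ₁, hδ₁, H₁⟩ := h.exists_nhds hP
    obtain ⟨δ₂, hδ₂, H₂⟩ := hW.2.2 (ε / t) (by positivity)
    refine ⟨min δ₁ (δ₂ / t), by positivity, fun w hw hwu => ?_⟩
    have hex := H₁ w (hwu.trans_le (min_le_left _ _))
    have hN := mem_normalCone_add_smul ht.le hw ((hex.mem_normalCone_iff_eq hex.1).2 rfl)
    have hsub : v + t • w - (v + t • u) = t • (w - u) := by module
    have hnorm : ‖v + t • w - (v + t • u)‖ = t * ‖w - u‖ := by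
      rw [hsub, norm_smul, Real.norm_eq_abs, abs_of_pos ht]
    have := H₂ (v + t • w) (mem_frontier_of_mem_normalCone (add_smul_mem h.1 hw) hw hN)
      (by
        rw [hnorm, mul_comm, ← lt_div_iff₀ ht]
        exact hwu.trans_le (min_le_right _ _)) w hN hw
    rw [hnorm, hsub, map_smul, ← mul_assoc, div_mul_cancel₀ _ ht.ne'] at this
    simpa using this
  have hk : e - t • W e = 0 := by simpa using key
  rw [sub_eq_zero] at hk
  rw [hk, smul_smul, inv_mul_cancel₀ ht.ne', one_smul, ← hk]

theorem exists_unit_orthogonal (hn : 2 ≤ n) (hu : ‖u‖ = 1) :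
    ∃ e : EuclideanSpace ℝ (Fin n), ‖e‖ = 1 ∧ inner ℝ u e = 0 := by
  have hpos : 0 < Module.finrank ℝ (ℝ ∙ u)ᗮ := by
    rw [finrank_orthogonal_span_unit (by omega) hu]; omega
  have := Module.finrank_pos_iff.1 hpos
  obtain ⟨e, he⟩ := exists_norm_eq (ℝ ∙ u)ᗮ zero_le_one
  exact ⟨e, he, Submodule.mem_orthogonal_singleton_iff_inner_right.1 e.2⟩

theorem Exposes.gaussCurvature_eq_top (hn : 2 ≤ n) (hP : IsConvexPolytope P) (h : Exposes P v u)
    (hu : ‖u‖ = 1) : gaussCurvature P v = ⊤ := by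
  rw [gaussCurvature, dif_neg]
  rintro ⟨κ, u', W, hW, -⟩
  have hN := (h.mem_normalCone_iff_eq h.1).2 rfl
  have hfr := mem_frontier_of_mem_normalCone h.1 hu hN
  obtain rfl : u = u' := hW.eq_of_mem_normalCone hfr hu hN
  obtain ⟨δ, hδ, H⟩ := h.exists_nhds hP
  obtain ⟨e, he, hue⟩ := exists_unit_orthogonal hn hu
  -- All `w` near `u` are normals at `v`, while a Weingarten map allows only one. So `u` would be
  -- isolated in the sphere, and even the identity would satisfy the smallness hypothesis.
  have hzero : ContinuousLinearMap.id ℝ _ e = 0 := by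
    refine apply_eq_zero_of_sphere_isLittleO hu (fun ε hε => ⟨δ, hδ, fun w hw hwu => ?_⟩) hue
    have hex := H w hwu
    obtain rfl := hW.eq_of_mem_normalCone hfr hw ((hex.mem_normalCone_iff_eq h.1).2 rfl)
    simp
  rw [ContinuousLinearMap.id_apply] at hzero
  simp [hzero] at he

/-- The tangent space is zero and the only unit vectors are `u` and `-u`, so `W = 0` works and every
determinant is empty. The point `z` keeps `-u` from being a normal near `x`. -/
theorem gaussCurvature_eq_one_of_dim_one (hn : n = 1) {K : Set (EuclideanSpace ℝ (Fin n))}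
    (hu : ‖u‖ = 1) (hux : u ∈ normalCone K x) (hlt : ∃ z ∈ K, inner ℝ z u < inner ℝ x u) :
    gaussCurvature K x = 1 := by
  have horth : ∀ e, inner ℝ u e = 0 → e = 0 := by
    intro e he
    have hfin : Module.finrank ℝ (ℝ ∙ u)ᗮ = 0 := by
      rw [finrank_orthogonal_span_unit (by omega) hu, hn]
    have hmem := Submodule.mem_orthogonal_singleton_iff_inner_right.2 he
    rwa [Submodule.finrank_eq_zero.1 hfin, Submodule.mem_bot] at hmem
  have hsign : ∀ w : EuclideanSpace ℝ (Fin n), ‖w‖ = 1 → w = u ∨ w = -u := by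
    intro w hw
    have h0 := horth (w - inner ℝ u w • u) (by
      rw [inner_sub_right, inner_smul_right, real_inner_self_eq_norm_sq, hu]; ring)
    have hwu := sub_eq_zero.1 h0
    have habs : |inner ℝ u w| = 1 := by
      rw [hwu, norm_smul, hu, mul_one, Real.norm_eq_abs] at hw
      exact hw
    rcases eq_or_eq_neg_of_abs_eq habs with h | h <;> rw [h] at hwu
    · left; rwa [one_smul] at hwu
    · right; rwa [neg_one_smul] at hwu
  have hone : ∀ κ, HasGaussCurvature K x κ → κ = 1 := by
    rintro κ ⟨u', W, hW, rfl⟩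
    have hzero : ∀ e, inner ℝ u' e = 0 → W e = (1 : ℝ) • e := by
      intro e he
      have : inner ℝ u e = 0 := by
        rcases hsign u' hW.1 with rfl | rfl
        · exact he
        · simpa using he
      simp [horth e this]
    rw [tangentialDet_eq_of_apply_eq_smul (by omega) hW.1 hzero, one_pow]
  obtain ⟨z, hz, hzx⟩ := hlt
  have hW : IsWeingartenMap K x u 0 := by
    refine ⟨hu, hux, fun ε hε => ⟨inner ℝ x u - inner ℝ z u, by linarith, ?_⟩⟩
    intro y _ hyx w hwy hw
    rcases hsign w hw with rfl | rfl
    · simpa using by positivity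
    · have h1 := mem_normalCone_iff.1 hwy z hz
      have h2 : inner ℝ (x - y) u ≤ ‖y - x‖ := by
        rw [norm_sub_rev]
        exact (real_inner_le_norm _ _).trans (by rw [hu, mul_one])
      simp only [inner_neg_right, inner_sub_left] at h1 h2
      linarith
  have hex : HasGaussCurvature K x 1 := by
    have h : HasGaussCurvature K x _ := ⟨u, 0, hW, rfl⟩
    rwa [hone _ h] at h
  rw [gaussCurvature_eq_of_unique hex hone, ENNReal.ofReal_one]

theorem exists_inner_lt_of_minSupport_pos (hP : IsCompact P) (hβ : 0 < minSupport P) (h : v ∈ P)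
    (hu : ‖u‖ = 1) (hv : u ∈ normalCone P v) : ∃ z ∈ P, inner ℝ z u < inner ℝ v u := by
  have hpos : ∀ w : EuclideanSpace ℝ (Fin n), ‖w‖ = 1 → 0 < supportFn P w := fun w hw =>
    hβ.trans_le (minSupport_le_supportFn hP ⟨w, by simpa using hw⟩)
  have h1 := hpos u hu
  rw [supportFn_eq_of_forall_le h (mem_normalCone_iff.1 hv)] at h1
  -- Positivity of the support function at `-u` yields a point on the far side of the origin.
  obtain ⟨_, ⟨z, hz, rfl⟩, hz0⟩ := exists_lt_of_lt_csSup
    ((nonempty_of_minSupport_pos hβ).image _) (hpos (-u) (by rwa [norm_neg]))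
  refine ⟨z, hz, ?_⟩
  simp only [inner_neg_right] at hz0
  linarith

theorem add_zero_smul_closedBall :
    P + (0 : ℝ) • Metric.closedBall (0 : EuclideanSpace ℝ (Fin n)) 1 = P := by
  rw [Set.zero_smul_set ⟨0, by simp⟩, add_zero]

/-- The curvature function of the parallel body of a polytope is almost everywhere constant; for
`n = 1` this includes the case `0 ^ 0 = 1`. -/
theorem Exposes.curvatureFn_add_smul_closedBall (hP : IsConvexPolytope P) (hβ : 0 < minSupport P)
    (h : Exposes P v u) (ht : 0 ≤ t) (hu : ‖u‖ = 1) :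
    curvatureFn (P + t • Metric.closedBall 0 1) u = ENNReal.ofReal (t ^ (n - 1)) := by
  have hn := pos_dim_of_minSupport_pos hβ
  rw [h.curvatureFn_eq hP.isCompact ht hu]
  rcases ht.eq_or_lt with rfl | ht
  · rw [add_zero_smul_closedBall, zero_smul, add_zero]
    have hN := (h.mem_normalCone_iff_eq h.1).2 rfl
    rcases eq_or_ne n 1 with hn1 | hn1
    · rw [gaussCurvature_eq_one_of_dim_one hn1 hu hN
        (exists_inner_lt_of_minSupport_pos hP.isCompact hβ h.1 hu hN)]
      simp [hn1]
    · rw [h.gaussCurvature_eq_top (by omega) hP hu, zero_pow (by omega)]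
      simp
  · rw [h.gaussCurvature_add_smul hn hP ht hu, ← ENNReal.ofReal_inv_of_pos (by positivity),
      inv_pow, inv_inv]

end Parallel

/-! ### Binomial series and termwise integration -/

section Series

theorem hasSum_choose_mul_pow (a : ℝ) {x : ℝ} (hx : |x| < 1) :
    HasSum (fun m : ℕ => Ring.choose a m * x ^ m) ((1 + x) ^ a) := by
  have := (Real.one_add_rpow_hasFPowerSeriesOnBall_zero (a := a)).hasSum (y := x)
    (by simpa [Metric.mem_eball, edist_dist, ENNReal.ofReal_lt_one] using hx)
  simpa [binomialSeries, FormalMultilinearSeries.coeff_ofScalars, mul_comm] using this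

theorem rpow_sub_natCast_mul_pow {h : ℝ} (hh : 0 < h) (a t : ℝ) (m : ℕ) :
    h ^ (a - m) * t ^ m = h ^ a * (t / h) ^ m := by
  rw [Real.rpow_sub hh, Real.rpow_natCast, div_pow]
  ring

theorem hasSum_rpow_add (a : ℝ) {h t : ℝ} (ht : 0 ≤ t) (hth : t < h) :
    HasSum (fun m : ℕ => Ring.choose a m * (h ^ (a - m) * t ^ m)) ((h + t) ^ a) := by
  have hh : 0 < h := ht.trans_lt hth
  have hx : |t / h| < 1 := by
    rw [abs_of_nonneg (by positivity), div_lt_one hh]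
    exact hth
  have := (hasSum_choose_mul_pow a hx).mul_left (h ^ a)
  rw [← Real.mul_rpow hh.le (by positivity), mul_add, mul_one, mul_div_cancel₀ _ hh.ne'] at this
  refine this.congr_fun fun m => ?_
  rw [rpow_sub_natCast_mul_pow hh]
  ring

/-- Dominated convergence: since `f ≥ β`, the terms are bounded by those of the binomial series at
`t / β < 1`, times a bound `C` for `f ^ a` on the compact space. -/
theorem hasSum_integral_rpow_add {X : Type*} [TopologicalSpace X] [CompactSpace X]
    [MeasurableSpace X] [BorelSpace X] (μ : Measure X) [IsFiniteMeasure μ] {f : X → ℝ}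
    (hf : Continuous f) {β t : ℝ} (hβ : ∀ x, β ≤ f x) (ht : 0 ≤ t) (htβ : t < β) (a : ℝ) :
    HasSum (fun m : ℕ => Ring.choose a m * (∫ x, f x ^ (a - m) ∂μ) * t ^ m)
      (∫ x, (f x + t) ^ a ∂μ) := by
  have hβ0 : 0 < β := ht.trans_lt htβ
  have hpos : ∀ x, 0 < f x := fun x => hβ0.trans_le (hβ x)
  have hcont : ∀ b : ℝ, Continuous fun x => f x ^ b := fun b =>
    hf.rpow_const fun x => Or.inl (hpos x).ne'
  obtain ⟨C, hC⟩ := (isCompact_range (hcont a)).bddAbove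
  have hC' : ∀ x, f x ^ a ≤ C := fun x => hC ⟨x, rfl⟩
  have hr : |t / β| < 1 := by
    rw [abs_of_nonneg (by positivity), div_lt_one hβ0]
    exact htβ
  have hsum : Summable fun m : ℕ => |Ring.choose a m * (t / β) ^ m| * C :=
    (hasSum_choose_mul_pow a hr).summable.abs.mul_right C
  have key := hasSum_integral_of_dominated_convergence (μ := μ)
    (F := fun (m : ℕ) x => Ring.choose a m * (f x ^ (a - m) * t ^ m))
    (f := fun x => (f x + t) ^ a)
    (fun m _ => |Ring.choose a m * (t / β) ^ m| * C)
    (fun m => (continuous_const.mul ((hcont _).mul continuous_const)).aestronglyMeasurable)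
    (fun m => Filter.Eventually.of_forall fun x => ?_)
    (Filter.Eventually.of_forall fun _ => hsum) (integrable_const _)
    (Filter.Eventually.of_forall fun x => hasSum_rpow_add a ht (htβ.trans_le (hβ x)))
  · refine key.congr_fun fun m => ?_
    rw [integral_const_mul, integral_mul_const, mul_assoc]
  · have h1 : 0 ≤ f x ^ a := Real.rpow_nonneg (hpos x).le a
    have h2 : (t / f x) ^ m ≤ (t / β) ^ m :=
      pow_le_pow_left₀ (div_nonneg ht (hpos x).le) (div_le_div_of_nonneg_left ht hβ0 (hβ x)) m
    have h3 : 0 ≤ (t / f x) ^ m := pow_nonneg (div_nonneg ht (hpos x).le) m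
    rw [rpow_sub_natCast_mul_pow (hpos x), Real.norm_eq_abs, abs_mul, abs_mul, abs_mul,
      abs_of_nonneg h1, abs_of_nonneg h3, abs_of_nonneg (h3.trans h2), mul_assoc]
    refine mul_le_mul_of_nonneg_left ?_ (abs_nonneg _)
    rw [mul_comm]
    exact mul_le_mul h2 (hC' x) h1 (h3.trans h2)

end Series

/-! ### Evaluation of the mixed affine surface area -/

section SurfaceArea

variable {n : ℕ} {P : Set (EuclideanSpace ℝ (Fin n))} {t : ℝ}

instance isFiniteMeasure_sphereMeasure (n : ℕ) : IsFiniteMeasure (sphereMeasure n) := by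
  unfold sphereMeasure
  infer_instance

theorem isClosed_sphericalNormalCone (v : EuclideanSpace ℝ (Fin n)) :
    IsClosed (sphericalNormalCone P v) := by
  have : sphericalNormalCone P v = ⋂ z ∈ P,
      {u : Metric.sphere (0 : EuclideanSpace ℝ (Fin n)) 1 |
        inner ℝ (u : EuclideanSpace ℝ (Fin n)) (z - v) ≤ 0} := by
    ext u
    simp [sphericalNormalCone, normalCone]
  rw [this]
  exact isClosed_biInter fun z _ => isClosed_le (by fun_prop) continuous_const

/-- Almost every `u` lies in the normal cone of exactly one vertex, so the indicators of the cones
sum to `1`. -/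
theorem finsum_integral_sphericalNormalCone (hP : IsConvexPolytope P) (hne : P.Nonempty)
    {g : Metric.sphere (0 : EuclideanSpace ℝ (Fin n)) 1 → ℝ}
    (hg : Integrable g (sphereMeasure n)) :
    ∑ᶠ v ∈ Set.extremePoints ℝ P, ∫ u in sphericalNormalCone P v, g u ∂(sphereMeasure n) =
      ∫ u, g u ∂(sphereMeasure n) := by
  have hfin := hP.finite_extremePoints
  rw [finsum_mem_eq_finite_toFinset_sum _ hfin]
  have hm : ∀ v, MeasurableSet (sphericalNormalCone P v) := fun v =>
    (isClosed_sphericalNormalCone v).measurableSet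
  simp_rw [← integral_indicator (hm _)]
  rw [← integral_finsetSum _ fun v _ => hg.indicator (hm v)]
  refine integral_congr_ae ?_
  filter_upwards [hP.ae_exposes hne] with u hu
  obtain ⟨v, hv⟩ := hu
  rw [Finset.sum_eq_single v]
  · rw [Set.indicator_of_mem]
    exact (hv.mem_normalCone_iff_eq hv.1).2 rfl
  · intro w hw hwv
    rw [Set.indicator_of_notMem]
    intro hmem
    exact hwv ((hv.mem_normalCone_iff_eq (hfin.mem_toFinset.1 hw).1).1 hmem)
  · intro hnot
    exact absurd (hfin.mem_toFinset.2 hv.mem_extremePoints) hnot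

theorem ofReal_mul_rpow_rpow {c h : ℝ} (hc : 0 < c) (hh : 0 < h) (r q : ℝ) :
    (ENNReal.ofReal c * ENNReal.ofReal h ^ r) ^ q = ENNReal.ofReal (c ^ q * h ^ (r * q)) := by
  rw [ENNReal.ofReal_rpow_of_pos hh, ← ENNReal.ofReal_mul hc.le,
    ENNReal.ofReal_rpow_of_pos (by positivity), Real.mul_rpow hc.le (by positivity),
    ← Real.rpow_mul hh.le]

/-- At `t = 0` the two power conventions agree for nonnegative exponents but not for negative ones,
where `0` has power `∞` in `ℝ≥0∞` and `0` in `ℝ`; `hcase` excludes that clash. -/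
theorem ofReal_pow_mul_rpow_rpow (hn : 0 < n) {h : ℝ} (ht : 0 ≤ t) (hh : 0 < h) (r q : ℝ)
    (hcase : 0 < t ∨ 0 ≤ ((n : ℝ) - 1) * q) :
    (ENNReal.ofReal (t ^ (n - 1)) * ENNReal.ofReal h ^ r) ^ q =
      ENNReal.ofReal (t ^ (((n : ℝ) - 1) * q) * h ^ (r * q)) := by
  have hcast : ((n - 1 : ℕ) : ℝ) = (n : ℝ) - 1 := by rw [Nat.cast_sub hn, Nat.cast_one]
  rcases ht.eq_or_lt with rfl | ht0
  · have hq := hcase.resolve_left (lt_irrefl 0)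
    rcases eq_or_ne n 1 with rfl | hn1
    · simpa using ofReal_mul_rpow_rpow one_pos hh r q
    · have hn2 : (0 : ℝ) < (n : ℝ) - 1 := by
        rw [← hcast]
        exact_mod_cast (by omega : 0 < n - 1)
      rw [zero_pow (by omega), ENNReal.ofReal_zero, zero_mul]
      rcases (nonneg_of_mul_nonneg_right hq hn2).eq_or_lt with rfl | hq0
      · simp
      · rw [ENNReal.zero_rpow_of_pos hq0, Real.zero_rpow (by positivity), zero_mul,
          ENNReal.ofReal_zero]
  · rw [ofReal_mul_rpow_rpow (by positivity) hh, ← hcast, Real.rpow_mul ht, Real.rpow_natCast]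

theorem lpCurvatureFn_add_smul_closedBall (hP : IsConvexPolytope P) (ht : 0 ≤ t)
    (htβ : t < minSupport P) (p : ℝ) {v : EuclideanSpace ℝ (Fin n)}
    {u : Metric.sphere (0 : EuclideanSpace ℝ (Fin n)) 1} (h : Exposes P v u) :
    lpCurvatureFn p (P + t • Metric.closedBall 0 1) u =
      ENNReal.ofReal (t ^ (n - 1)) * ENNReal.ofReal (supportFn P u + t) ^ (1 - p) := by
  have hu : ‖(u : EuclideanSpace ℝ (Fin n))‖ = 1 := by simp
  rw [lpCurvatureFn, h.curvatureFn_add_smul_closedBall hP (ht.trans_lt htβ) ht hu,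
    h.supportFn_add_smul_closedBall ht hu]

theorem continuous_supportFn_sphere (hP : IsConvexPolytope P) :
    Continuous fun u : Metric.sphere (0 : EuclideanSpace ℝ (Fin n)) 1 => supportFn P u :=
  (continuous_supportFn hP.isCompact).comp continuous_subtype_val

theorem integrable_supportFn_add_rpow (hP : IsConvexPolytope P) (hβ : 0 < minSupport P)
    (ht : 0 ≤ t) (a : ℝ) :
    Integrable (fun u : Metric.sphere (0 : EuclideanSpace ℝ (Fin n)) 1 => (supportFn P u + t) ^ a)
      (sphereMeasure n) := by
  have hc : Continuous fun u : Metric.sphere (0 : EuclideanSpace ℝ (Fin n)) 1 =>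
      (supportFn P u + t) ^ a :=
    ((continuous_supportFn_sphere hP).add continuous_const).rpow_const fun u => Or.inl
      (add_pos_of_pos_of_nonneg (hβ.trans_le (minSupport_le_supportFn hP.isCompact u)) ht).ne'
  exact hc.integrable_of_hasCompactSupport (HasCompactSupport.of_compactSpace _)

theorem integrable_supportFn_rpow (hP : IsConvexPolytope P) (hβ : 0 < minSupport P) (a : ℝ) :
    Integrable (fun u : Metric.sphere (0 : EuclideanSpace ℝ (Fin n)) 1 => supportFn P u ^ a)
      (sphereMeasure n) := by
  simpa using integrable_supportFn_add_rpow hP hβ le_rfl a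

theorem mixedAffineSurfaceArea_add_smul_closedBall (hP : IsConvexPolytope P) (ht : 0 ≤ t)
    (htβ : t < minSupport P) (p s : ℝ)
    (hcase : 0 < t ∨ 0 ≤ ((n : ℝ) - 1) * (((n : ℝ) - s) / ((n : ℝ) + p))) :
    mixedAffineSurfaceArea p s (P + t • Metric.closedBall 0 1) =
      ENNReal.ofReal (t ^ (((n : ℝ) - 1) * (((n : ℝ) - s) / ((n : ℝ) + p))) *
        ∫ u : Metric.sphere (0 : EuclideanSpace ℝ (Fin n)) 1,
          (supportFn P u + t) ^ ((1 - p) * (((n : ℝ) - s) / ((n : ℝ) + p))) ∂(sphereMeasure n)) := by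
  have hβ := ht.trans_lt htβ
  have hpos : ∀ u : Metric.sphere (0 : EuclideanSpace ℝ (Fin n)) 1, 0 < supportFn P u + t :=
    fun u => add_pos_of_pos_of_nonneg (hβ.trans_le (minSupport_le_supportFn hP.isCompact u)) ht
  rw [← integral_const_mul, ofReal_integral_eq_lintegral_ofReal
    ((integrable_supportFn_add_rpow hP hβ ht _).const_mul _)
    (Filter.Eventually.of_forall fun u =>
      mul_nonneg (Real.rpow_nonneg ht _) (Real.rpow_nonneg (hpos u).le _))]
  refine lintegral_congr_ae ?_
  filter_upwards [hP.ae_exposes (nonempty_of_minSupport_pos hβ)] with u hu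
  obtain ⟨v, hv⟩ := hu
  simp only [lpCurvatureFn_add_smul_closedBall hP ht htβ p hv]
  exact ofReal_pow_mul_rpow_rpow (pos_dim_of_minSupport_pos hβ) ht (hpos u) _ _ hcase

theorem mixedAffineSurfaceArea_eq_top (hP : IsConvexPolytope P) (hβ : 0 < minSupport P) (p s : ℝ)
    (hneg : ((n : ℝ) - 1) * (((n : ℝ) - s) / ((n : ℝ) + p)) < 0) :
    mixedAffineSurfaceArea p s (P + (0 : ℝ) • Metric.closedBall 0 1) = ⊤ := by
  have hn := pos_dim_of_minSupport_pos hβ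
  have hn1 : (0 : ℝ) ≤ (n : ℝ) - 1 := sub_nonneg.2 (by exact_mod_cast hn)
  have hne : n ≠ 1 := by
    rintro rfl
    simp at hneg
  have hq : ((n : ℝ) - s) / ((n : ℝ) + p) < 0 := by
    by_contra hq
    exact absurd hneg (not_lt.2 (mul_nonneg hn1 (not_lt.1 hq)))
  have htop : mixedAffineSurfaceArea p s (P + (0 : ℝ) • Metric.closedBall 0 1) =
      ∫⁻ _, ⊤ ∂(sphereMeasure n) := by
    refine lintegral_congr_ae ?_
    filter_upwards [hP.ae_exposes (nonempty_of_minSupport_pos hβ)] with u hu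
    obtain ⟨v, hv⟩ := hu
    rw [lpCurvatureFn_add_smul_closedBall hP le_rfl hβ p hv, zero_pow (by omega),
      ENNReal.ofReal_zero, zero_mul, ENNReal.zero_rpow_of_neg hq]
  have : NeZero n := ⟨hn.ne'⟩
  -- The integral of `∞` is `∞` because the sphere has nonzero measure.
  rw [htop, lintegral_const, ENNReal.top_mul]
  rw [Ne, Measure.measure_univ_eq_zero]
  exact Measure.toSphere_ne_zero _

end SurfaceArea

/-! ### The expansion in powers of `t` -/

theorem mainTheorem8 {n : ℕ} (P : Set (EuclideanSpace ℝ (Fin n))) (hP : IsConvexPolytope P)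
    (t : ℝ) (ht0 : 0 ≤ t) (htβ : t < minSupport P)
    (s p : ℝ) (hp : p ≠ -(n : ℝ))
    (hlt : (n : ℝ) < s → p ∉ Set.Ioc (-s) (-(n : ℝ)))
    (hgt : s < (n : ℝ) → p ∉ Set.Ico (-(n : ℝ)) (-s)) :
    (∀ m : ℕ, ∀ v ∈ Set.extremePoints ℝ P,
      IntegrableOn (fun u : Metric.sphere (0 : EuclideanSpace ℝ (Fin n)) 1 =>
          supportFn P u ^ (((n : ℝ) - s) * (1 - p) / ((n : ℝ) + p) - (m : ℝ)))
        (sphericalNormalCone P v) (sphereMeasure n)) ∧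
    ((0 < t ∨ 0 ≤ ((n : ℝ) - 1) * ((n : ℝ) - s) / ((n : ℝ) + p)) →
      mixedAffineSurfaceArea p s (P + t • Metric.closedBall 0 1) ≠ ⊤ ∧
      HasSum
        (fun m : ℕ =>
          Ring.choose (((n : ℝ) - s) * (1 - p) / ((n : ℝ) + p)) m *
            (∑ᶠ v ∈ Set.extremePoints ℝ P, ∫ u in sphericalNormalCone P v,
              supportFn P u ^ (((n : ℝ) - s) * (1 - p) / ((n : ℝ) + p) - (m : ℝ))
                ∂(sphereMeasure n)) *
            t ^ ((m : ℝ) + ((n : ℝ) - 1) * ((n : ℝ) - s) / ((n : ℝ) + p)))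
        (mixedAffineSurfaceArea p s (P + t • Metric.closedBall 0 1)).toReal) ∧
    ((t = 0 ∧ ((n : ℝ) - 1) * ((n : ℝ) - s) / ((n : ℝ) + p) < 0) →
      mixedAffineSurfaceArea p s (P + t • Metric.closedBall 0 1) = ⊤) := by

  have hβ : 0 < minSupport P := ht0.trans_lt htβ
  have hα : (1 - p) * (((n : ℝ) - s) / ((n : ℝ) + p)) =
      ((n : ℝ) - s) * (1 - p) / ((n : ℝ) + p) := by ring
  have hE : ((n : ℝ) - 1) * (((n : ℝ) - s) / ((n : ℝ) + p)) =
      ((n : ℝ) - 1) * ((n : ℝ) - s) / ((n : ℝ) + p) := by ring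
  refine ⟨fun m v _ => (integrable_supportFn_rpow hP hβ _).integrableOn, fun hcase => ?_, ?_⟩
  · rw [mixedAffineSurfaceArea_add_smul_closedBall hP ht0 htβ p s (by rwa [hE]), hα, hE]
    refine ⟨ENNReal.ofReal_ne_top, ?_⟩
    rw [ENNReal.toReal_ofReal (mul_nonneg (Real.rpow_nonneg ht0 _) (integral_nonneg fun u =>
      Real.rpow_nonneg (add_nonneg (hβ.le.trans (minSupport_le_supportFn hP.isCompact u)) ht0) _))]
    refine ((hasSum_integral_rpow_add (sphereMeasure n) (continuous_supportFn_sphere hP)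
      (minSupport_le_supportFn hP.isCompact) ht0 htβ _).mul_left _).congr_fun fun m => ?_
    rw [finsum_integral_sphericalNormalCone hP (nonempty_of_minSupport_pos hβ)
      (integrable_supportFn_rpow hP hβ _)]
    -- At `t = 0` splitting the exponent is valid because both summands are nonnegative.
    have hpow : t ^ ((m : ℝ) + ((n : ℝ) - 1) * ((n : ℝ) - s) / ((n : ℝ) + p)) =
        t ^ (((n : ℝ) - 1) * ((n : ℝ) - s) / ((n : ℝ) + p)) * t ^ m := by
      rcases hcase with ht | hexp
      · rw [Real.rpow_add ht, Real.rpow_natCast, mul_comm]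
      · rw [Real.rpow_add_of_nonneg ht0 m.cast_nonneg hexp, Real.rpow_natCast, mul_comm]
    rw [hpow]
    ring
  · rintro ⟨rfl, hneg⟩
    exact mixedAffineSurfaceArea_eq_top hP hβ p s (by rwa [hE])
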